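/- Let $A$ be an alphabet, i.e. a (possibly infinite) partially ordered set equipped with an order-preserving involution $a\mapsto\bar a$. Let $A^*$ be the set of words over $A$ with concatenation, the involution $\overline{a_0\cdots a_{n-1}}=\overline{a_{n-1}}\cdots\overline{a_0}$, and the Higman ordering ($\alpha\le\beta$ iff $\alpha$ is letterwise below a subsequence of $\beta$). Let $\mathcal H=\mathbf F(A^*)$ be the set of final segments (up-closed subsets) of $A^*$, ordered by reverse inclusion, with concatenation $X\cdot Y=\{\alpha\beta:\alpha\in X,\beta\in Y\}$, least and neutral element $1=A^*$, and involution $\overline X=\{\bar\alpha:\alpha\in X\}$. A metric space over $\mathcal H$ is a set $E$ with a map $d:E\times E\to\mathcal H$ such that, for all $x,y,z\in E$, (1) $d(x,y)=1$ iff $x=y$; (2) $d(x,y)\le d(x,z)\cdot d(z,y)$; (3) $d(x,y)=\overline{d(y,x)}$. A map $f:E\to E'$ is a contraction if $d'(f(x),f(y))\le d(x,y)$ for all $x,y$, and an isometry if equality always holds. A space $E$ is injective if for every contraction $f:E_1\to E$ and every isometry $g:E_1\to E_2$ there is a contraction $h:E_2\to E$ with $h\circ g=f$. A contraction $f:E\to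 E'$ is essential if for every contraction $g:E'\to E''$, $g\circ f$ is an isometry iff $g$ is an isometry. An injective envelope of $E$ is an essential contraction from $E$ into an injective space. Theorem. Every finite metric space $E$ over $\mathcal H$ has an injective envelope $E\to\mathcal N(E)$, and it is unique up to a surjective isometry commuting with the maps from $E$. Moreover, the following conditions are equivalent: (i) $A$ is well-quasi-ordered (equivalently, $A$ is well-founded and has no infinite antichain); (ii) the injective envelope $\mathcal N(E)$ of every finite metric space $E$ over $\mathcal H$ is finite. -/

import Mathlib

universe u v w

namespace FinalSegmentMetric

/-- A Heyting algebra in the sense of generalized metric spaces (the dual of an integral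
involutive quantale): a complete lattice with a monoid operation whose neutral element is the
least element, an isotone involution reversing the operation, and distributivity of the operation
over arbitrary infima. (This is unrelated to Mathlib's `HeytingAlgebra`.) -/
class InvolutiveHeyting (H : Type u) extends CompleteLattice H, Monoid H where
  /-- The involution `p ↦ p̄`. -/
  bar : H → H
  bar_bar : ∀ p : H, bar (bar p) = p
  bar_mono : ∀ p q : H, p ≤ q → bar p ≤ bar q
  bar_mul : ∀ p q : H, bar (p * q) = bar q * bar p
  one_le : ∀ p : H, 1 ≤ p
  sInf_mul : ∀ (S : Set H) (q : H), sInf S * q = ⨅ p ∈ S, p * q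

/-- An `H`-metric space: a set `E` with an `H`-distance on it. -/
class HMetricSpace (H : Type u) [InvolutiveHeyting H] (E : Type v) where
  /-- The distance. -/
  d : E → E → H
  d_eq_one : ∀ x y : E, d x y = 1 ↔ x = y
  d_triangle : ∀ x y z : E, d x y ≤ d x z * d z y
  d_bar : ∀ x y : E, d x y = InvolutiveHeyting.bar (d y x)

section Maps

variable (H : Type u) [InvolutiveHeyting H]

/-- Contractions, i.e. non-expansive maps. -/
def IsContraction {E : Type v} {E' : Type w} [HMetricSpace H E] [HMetricSpace H E']
    (f : E → E') : Prop :=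
  ∀ x y : E, (HMetricSpace.d (f x) (f y) : H) ≤ HMetricSpace.d x y

/-- Isometries (not necessarily surjective). -/
def IsIsometry {E : Type v} {E' : Type w} [HMetricSpace H E] [HMetricSpace H E']
    (f : E → E') : Prop :=
  ∀ x y : E, (HMetricSpace.d (f x) (f y) : H) = HMetricSpace.d x y

/-- `E` is injective: every contraction into `E` extends along every isometry. -/
def IsInjectiveSpace (E : Type v) [HMetricSpace H E] : Prop :=
  ∀ (E₁ E₂ : Type v) [HMetricSpace H E₁] [HMetricSpace H E₂] (f : E₁ → E) (g : E₁ → E₂),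
    IsContraction H f → IsIsometry H g → ∃ h : E₂ → E, IsContraction H h ∧ h ∘ g = f

/-- Essential contractions: for every contraction `g` out of `E'`, the map `g ∘ f` is an isometry
if and only if `g` is an isometry. -/
def IsEssential {E E' : Type v} [HMetricSpace H E] [HMetricSpace H E'] (f : E → E') : Prop :=
  IsContraction H f ∧
    ∀ (E'' : Type v) [HMetricSpace H E''] (g : E' → E''), IsContraction H g →
      (IsIsometry H (g ∘ f) ↔ IsIsometry H g)

/-- `f : E → E'` exhibits `E'` as an injective envelope of `E`: `f` is an essential contraction and
`E'` is injective. -/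
def IsInjectiveEnvelope {E E' : Type v} [HMetricSpace H E] [HMetricSpace H E']
    (f : E → E') : Prop :=
  IsEssential H f ∧ IsInjectiveSpace H E'

end Maps

/-- An ordered alphabet equipped with an order preserving involution. -/
class OrderedAlphabet (A : Type u) extends PartialOrder A where
  /-- The involution on letters. -/
  bar : A → A
  bar_bar : ∀ a : A, bar (bar a) = a
  bar_mono : ∀ a b : A, a ≤ b → bar a ≤ bar b

/-- The set `A*` of words over `A`. -/
def Word (A : Type u) : Type u := List A

section Words

variable {A : Type u}

/-- A list of letters, seen as a word. -/
def Word.ofList (l : List A) : Word A := l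

/-- The letters of a word. -/
def Word.toList (α : Word A) : List A := α

/-- Words with concatenation form the free monoid. -/
instance : Monoid (Word A) where
  mul α β := Word.ofList (α.toList ++ β.toList)
  one := Word.ofList []
  mul_assoc α β γ := List.append_assoc α.toList β.toList γ.toList
  one_mul α := List.nil_append α.toList
  mul_one α := List.append_nil α.toList

theorem Word.toList_mul (α β : Word A) : (α * β).toList = α.toList ++ β.toList := rfl

theorem Word.toList_one : (1 : Word A).toList = [] := rfl

/-- The Higman ordering: `α ≤ β` iff `α` is letterwise below some subsequence of `β`. -/
instance [PartialOrder A] : PartialOrder (Word A) where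
  le α β := List.SublistForall₂ (· ≤ ·) α.toList β.toList
  le_refl α := List.sublistForall₂_iff.2
    ⟨α.toList, List.forall₂_refl _, List.Sublist.refl _⟩
  le_trans α β γ h₁ h₂ := _root_.trans h₁ h₂
  le_antisymm α β h₁ h₂ := by
    obtain ⟨l, hl, hs⟩ := List.sublistForall₂_iff.1 h₁
    obtain ⟨m, hm, ht⟩ := List.sublistForall₂_iff.1 h₂
    have e₁ := hl.length_eq
    have e₂ := hm.length_eq
    have e₃ := hs.length_le
    have e₄ := ht.length_le
    obtain rfl := hs.eq_of_length (by omega)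
    obtain rfl := ht.eq_of_length (by omega)
    have key : ∀ {a b : List A}, List.Forall₂ (· ≤ ·) a b → List.Forall₂ (· ≤ ·) b a → a = b := by
      intro a b h
      induction h with
      | nil => exact fun _ => rfl
      | cons hab _ ih =>
        intro h'
        cases h' with
        | cons hba h'' => rw [le_antisymm hab hba, ih h'']
    exact key hl hm

theorem Word.le_iff [PartialOrder A] (α β : Word A) :
    α ≤ β ↔ List.SublistForall₂ (· ≤ ·) α.toList β.toList := Iff.rfl

theorem Word.one_le [PartialOrder A] (α : Word A) : 1 ≤ α := List.SublistForall₂.nil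

theorem Word.mul_le_mul [PartialOrder A] {α α' β β' : Word A} (h : α ≤ α') (h' : β ≤ β') :
    α * β ≤ α' * β' := by
  obtain ⟨l, hl, hs⟩ := List.sublistForall₂_iff.1 h
  obtain ⟨m, hm, ht⟩ := List.sublistForall₂_iff.1 h'
  exact List.sublistForall₂_iff.2 ⟨l ++ m, List.rel_append hl hm, hs.append ht⟩

theorem Word.exists_of_mul_le [PartialOrder A] {α β γ : Word A} (h : α * β ≤ γ) :
    ∃ α' β' : Word A, α ≤ α' ∧ β ≤ β' ∧ α' * β' = γ := by
  obtain ⟨l, hl, hs⟩ := List.sublistForall₂_iff.1 h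
  rw [Word.toList_mul] at hl
  obtain ⟨l₁, l₂, h₁, h₂, rfl⟩ : ∃ l₁ l₂, List.Forall₂ (· ≤ ·) α.toList l₁ ∧
      List.Forall₂ (· ≤ ·) β.toList l₂ ∧ l = l₁ ++ l₂ :=
    ⟨l.take α.toList.length, l.drop α.toList.length,
      by simpa using List.forall₂_take α.toList.length hl,
      by simpa using List.forall₂_drop α.toList.length hl, (List.take_append_drop _ _).symm⟩
  obtain ⟨r₁, r₂, hr, hr₁, hr₂⟩ := List.append_sublist_iff.1 hs
  exact ⟨Word.ofList r₁, Word.ofList r₂, List.sublistForall₂_iff.2 ⟨l₁, h₁, hr₁⟩,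
    List.sublistForall₂_iff.2 ⟨l₂, h₂, hr₂⟩, hr.symm⟩

/-- The involution on words: reverse the word and apply the involution to each letter. -/
def Word.bar [OrderedAlphabet A] (α : Word A) : Word A :=
  Word.ofList (α.toList.map OrderedAlphabet.bar).reverse

theorem Word.bar_bar [OrderedAlphabet A] (α : Word A) : α.bar.bar = α := by
  have h : (OrderedAlphabet.bar : A → A) ∘ OrderedAlphabet.bar = id :=
    funext OrderedAlphabet.bar_bar
  change ((α.toList.map OrderedAlphabet.bar).reverse.map OrderedAlphabet.bar).reverse = α.toList
  rw [List.map_reverse, List.reverse_reverse, List.map_map, h, List.map_id]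

theorem Word.bar_mul [OrderedAlphabet A] (α β : Word A) : (α * β).bar = β.bar * α.bar := by
  change ((α.toList ++ β.toList).map OrderedAlphabet.bar).reverse =
    (β.toList.map OrderedAlphabet.bar).reverse ++ (α.toList.map OrderedAlphabet.bar).reverse
  simp

theorem Word.bar_mono [OrderedAlphabet A] {α β : Word A} (h : α ≤ β) : α.bar ≤ β.bar := by
  obtain ⟨l, hl, hs⟩ := List.sublistForall₂_iff.1 h
  refine List.sublistForall₂_iff.2 ⟨(l.map OrderedAlphabet.bar).reverse, ?_, ?_⟩
  · refine List.rel_reverse (List.rel_map ?_ hl)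
    exact fun a b hab => OrderedAlphabet.bar_mono a b hab
  · exact (hs.map _).reverse

end Words

/-- The set `F(A*)` of final segments of `A*`. Mathlib orders `UpperSet` by reverse inclusion:
`X ≤ Y` iff `Y ⊆ X`, so suprema are intersections and infima are unions. -/
abbrev FinalSegments (A : Type u) [OrderedAlphabet A] : Type u := UpperSet (Word A)

section FinalSegments

variable {A : Type u} [OrderedAlphabet A]

/-- Concatenation of final segments. -/
def FinalSegments.concat (X Y : FinalSegments A) : FinalSegments A where
  carrier := {γ | ∃ α ∈ X, ∃ β ∈ Y, α * β = γ}
  upper' := by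
    rintro γ δ hle ⟨α, hα, β, hβ, rfl⟩
    obtain ⟨α', β', h₁, h₂, rfl⟩ := Word.exists_of_mul_le hle
    exact ⟨α', X.upper h₁ hα, β', Y.upper h₂ hβ, rfl⟩

/-- The involution on final segments: `{ᾱ : α ∈ X}`. -/
def FinalSegments.bar (X : FinalSegments A) : FinalSegments A where
  carrier := Word.bar '' (X : Set (Word A))
  upper' := by
    rintro γ δ hle ⟨α, hα, rfl⟩
    refine ⟨δ.bar, X.upper ?_ hα, Word.bar_bar δ⟩
    have := Word.bar_mono hle
    rwa [Word.bar_bar] at this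

theorem FinalSegments.mem_concat {X Y : FinalSegments A} {γ : Word A} :
    γ ∈ FinalSegments.concat X Y ↔ ∃ α ∈ X, ∃ β ∈ Y, α * β = γ := Iff.rfl

theorem FinalSegments.mem_bar {X : FinalSegments A} {γ : Word A} :
    γ ∈ FinalSegments.bar X ↔ γ.bar ∈ X := by
  constructor
  · rintro ⟨α, hα, rfl⟩
    rwa [Word.bar_bar]
  · exact fun h => ⟨γ.bar, h, Word.bar_bar γ⟩

/-- `F(A*)`, ordered by reverse inclusion, with concatenation, `1 = A*` and the involution, is a
Heyting algebra. -/
instance : InvolutiveHeyting (FinalSegments A) where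
  mul := FinalSegments.concat
  one := ⊥
  mul_assoc X Y Z := by
    refine SetLike.ext fun γ => ⟨?_, ?_⟩
    · rintro ⟨_, ⟨α, hα, β, hβ, rfl⟩, δ, hδ, rfl⟩
      exact ⟨α, hα, β * δ, ⟨β, hβ, δ, hδ, rfl⟩, (mul_assoc α β δ).symm⟩
    · rintro ⟨α, hα, _, ⟨β, hβ, δ, hδ, rfl⟩, rfl⟩
      exact ⟨α * β, ⟨α, hα, β, hβ, rfl⟩, δ, hδ, mul_assoc α β δ⟩
  one_mul X := by
    refine SetLike.ext fun γ => ⟨?_, fun h => FinalSegments.mem_concat.2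
      ⟨1, UpperSet.mem_bot, γ, h, one_mul γ⟩⟩
    rintro ⟨α, -, β, hβ, rfl⟩
    refine X.upper ?_ hβ
    simpa using Word.mul_le_mul (Word.one_le α) (le_refl β)
  mul_one X := by
    refine SetLike.ext fun γ => ⟨?_, fun h => FinalSegments.mem_concat.2
      ⟨γ, h, 1, UpperSet.mem_bot, mul_one γ⟩⟩
    rintro ⟨α, hα, β, -, rfl⟩
    refine X.upper ?_ hα
    simpa using Word.mul_le_mul (le_refl α) (Word.one_le β)
  bar := FinalSegments.bar
  bar_bar X := SetLike.ext fun γ => by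
    rw [FinalSegments.mem_bar, FinalSegments.mem_bar, Word.bar_bar]
  bar_mono X Y h := fun γ hγ => FinalSegments.mem_bar.2 (h (FinalSegments.mem_bar.1 hγ))
  bar_mul X Y := by
    refine SetLike.ext fun γ => FinalSegments.mem_bar.trans ⟨?_, ?_⟩
    · rintro ⟨α, hα, β, hβ, h⟩
      refine ⟨β.bar, ⟨β, hβ, rfl⟩, α.bar, ⟨α, hα, rfl⟩, ?_⟩
      rw [← Word.bar_mul, h, Word.bar_bar]
    · rintro ⟨_, ⟨β, hβ, rfl⟩, _, ⟨α, hα, rfl⟩, rfl⟩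
      refine ⟨α, hα, β, hβ, ?_⟩
      rw [← Word.bar_mul, Word.bar_bar]
  one_le X := bot_le
  sInf_mul S Y := by
    refine SetLike.ext fun γ => ?_
    rw [UpperSet.mem_iInf₂_iff]
    constructor
    · rintro ⟨α, hα, β, hβ, rfl⟩
      obtain ⟨X, hX, hαX⟩ := UpperSet.mem_sInf_iff.1 hα
      exact ⟨X, hX, α, hαX, β, hβ, rfl⟩
    · rintro ⟨X, hX, α, hα, β, hβ, rfl⟩
      exact ⟨α, UpperSet.mem_sInf_iff.2 ⟨X, hX, hα⟩, β, hβ, rfl⟩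

theorem FinalSegments.mul_def (X Y : FinalSegments A) : X * Y = FinalSegments.concat X Y := rfl

theorem FinalSegments.one_def : (1 : FinalSegments A) = ⊥ := rfl

theorem FinalSegments.bar_def (X : FinalSegments A) :
    InvolutiveHeyting.bar X = FinalSegments.bar X := rfl

end FinalSegments

end FinalSegmentMetric

open FinalSegmentMetric

/-!
The statement is derived from an explicit model of the injective envelope over an arbitrary
involutive Heyting algebra `H`.

A *form* on `E` is a map `h : E → H` with `d x y ≤ h x * bar (h y)`: the distances to an imaginary
point, as far as the triangle inequality through that point is concerned. The least `r` with
`h x ≤ k x * bar r` and `k x ≤ h x * r` for all `x` is a distance on forms. The space of all forms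
is injective by a direct formula (`Form.exists_extension`). The pointwise minimal forms make up the
tight span. Zorn's lemma, applied to the contractions `p` of the space of forms with `p h ≤ h`,
gives a retraction onto the tight span (`Form.exists_tightening`), so the tight span is injective too.
The Kuratowski map `x ↦ d · x` into it is essential: if `g` is isometric on the image of `E`, then
the distances to `g h` constitute a form below the minimal form `h`, hence equal to it. Uniqueness
of injective envelopes is formal (`IsInjectiveEnvelope.exists_surjective_isometry`).

If `A` is well-quasi-ordered then, by Higman's lemma, every final segment of `A*` is finitely
generated, so it has only finitely many right quotients `{α | α * β ∈ X}`
(`finite_range_rightQuotient`). A minimal form is determined by sets of such quotients of the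
distances of `E`, so a finite `E` has finitely many of them.

If `A` is not well-quasi-ordered, take a bad sequence `a` and put `w n = (a n) ^ (n + 1)`. Since a
later letter of a bad sequence is never above an earlier one while `w n` gets longer, the word
`w m * w n` lies in the final segment `X` generated by the squares `w k * w k` only if `m = n`. On
the two-point space with distance `X`, the minimal forms below `(↑ w n, ↑ bar (w n))` are therefore
pairwise distinct.
-/

namespace FinalSegmentMetric

open InvolutiveHeyting HMetricSpace

/-! ### Arithmetic of involutive Heyting algebras -/

section Heyting

variable {H : Type u} [InvolutiveHeyting H]

theorem bar_one : bar (1 : H) = 1 :=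
  le_antisymm ((bar_mono _ _ (InvolutiveHeyting.one_le _)).trans_eq (bar_bar 1))
    (InvolutiveHeyting.one_le _)

theorem bar_le_iff {p q : H} : bar p ≤ q ↔ p ≤ bar q :=
  ⟨fun h => by simpa only [bar_bar] using bar_mono _ _ h,
    fun h => by simpa only [bar_bar] using bar_mono _ _ h⟩

theorem bar_iInf {ι : Sort*} (f : ι → H) : bar (⨅ i, f i) = ⨅ i, bar (f i) := by
  refine le_antisymm (le_iInf fun i => bar_mono _ _ (iInf_le f i)) ?_
  have : bar (⨅ i, bar (f i)) ≤ ⨅ i, f i :=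
    le_iInf fun i => bar_le_iff.2 (iInf_le (fun i => bar (f i)) i)
  exact bar_le_iff.1 this

theorem iInf_mul {ι : Sort*} (f : ι → H) (q : H) : (⨅ i, f i) * q = ⨅ i, f i * q := by
  rw [iInf, InvolutiveHeyting.sInf_mul, iInf_range]

theorem mul_iInf {ι : Sort*} (q : H) (f : ι → H) : q * (⨅ i, f i) = ⨅ i, q * f i := by
  rw [← bar_bar (q * _), bar_mul, bar_iInf, iInf_mul, bar_iInf]
  exact iInf_congr fun i => by rw [← bar_mul, bar_bar]

instance : MulRightMono H where
  elim q a b h := by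
    change a * q ≤ b * q
    have e : a = ⨅ i : Bool, cond i a b := by rw [iInf_bool_eq]; exact (inf_eq_left.2 h).symm
    rw [e, iInf_mul]
    exact iInf_le (fun i : Bool => cond i a b * q) false

instance : MulLeftMono H where
  elim q a b h := by
    change q * a ≤ q * b
    have := mul_le_mul_left (bar_mono _ _ h) (bar q)
    rw [← bar_mul, ← bar_mul] at this
    simpa only [bar_bar] using bar_mono _ _ this

end Heyting

section Spaces

variable {H : Type u} [InvolutiveHeyting H] {E : Type v} [HMetricSpace H E]

theorem d_self (x : E) : (d x x : H) = 1 := (d_eq_one x x).2 rfl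

theorem IsIsometry.isContraction {E' : Type w} [HMetricSpace H E'] {f : E → E'}
    (hf : IsIsometry H f) : IsContraction H f := fun x y => (hf x y).le

theorem IsIsometry.injective {E' : Type w} [HMetricSpace H E'] {f : E → E'}
    (hf : IsIsometry H f) : Function.Injective f := fun x y h =>
  (d_eq_one (H := H) x y).1 (by rw [← hf, h, d_self])

variable (H E) in
/-- Forms on `E`: maps `h : E → H` which satisfy the triangle inequalities `d x y ≤ h x * bar (h y)`
that distances `h x = d x p` to a further point `p` would satisfy. The other triangle inequality,
`h x ≤ d x y * h y`, is not required; it holds for minimal forms. -/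
@[ext]
structure Form where
  /-- The underlying map. -/
  toFun : E → H
  d_le : ∀ x y : E, d x y ≤ toFun x * bar (toFun y)

namespace Form

/-! ### The space of forms -/

/-- Forms are compared pointwise. -/
instance : PartialOrder (Form H E) := PartialOrder.lift Form.toFun fun _ _ => Form.ext

/-- The distance of two forms: the least `r` such that both triangle inequalities hold for a pair
of points at distance `r` with the given distances to `E`. -/
def dist (h k : Form H E) : H :=
  sInf {r | ∀ x, h.toFun x ≤ k.toFun x * bar r ∧ k.toFun x ≤ h.toFun x * r}

theorem dist_le {h k : Form H E} {r : H} (h₁ : ∀ x, h.toFun x ≤ k.toFun x * bar r)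
    (h₂ : ∀ x, k.toFun x ≤ h.toFun x * r) : dist h k ≤ r :=
  sInf_le fun x => ⟨h₁ x, h₂ x⟩

theorem le_mul_dist (h k : Form H E) (x : E) : k.toFun x ≤ h.toFun x * dist h k := by
  rw [dist, sInf_eq_iInf', mul_iInf]
  exact le_iInf fun r => (r.2 x).2

theorem le_mul_bar_dist (h k : Form H E) (x : E) : h.toFun x ≤ k.toFun x * bar (dist h k) := by
  rw [dist, sInf_eq_iInf', bar_iInf, mul_iInf]
  exact le_iInf fun r => (r.2 x).1

theorem dist_le_bar (h k : Form H E) : dist h k ≤ bar (dist k h) :=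
  dist_le (fun x => by rw [bar_bar]; exact le_mul_dist k h x) (le_mul_bar_dist k h)

instance : HMetricSpace H (Form H E) where
  d := dist
  d_eq_one h k := by
    refine ⟨fun e => le_antisymm (fun x => ?_) fun x => ?_, ?_⟩
    · simpa only [e, bar_one, mul_one] using le_mul_bar_dist h k x
    · simpa only [e, mul_one] using le_mul_dist h k x
    · rintro rfl
      exact le_antisymm (dist_le (fun x => by rw [bar_one, mul_one]) fun x => by rw [mul_one])
        (InvolutiveHeyting.one_le _)
  d_triangle h k l := by
    refine dist_le (fun x => ?_) fun x => ?_
    · rw [bar_mul, ← mul_assoc]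
      exact (le_mul_bar_dist h l x).trans (mul_le_mul_left (le_mul_bar_dist l k x) _)
    · rw [← mul_assoc]
      exact (le_mul_dist l k x).trans (mul_le_mul_left (le_mul_dist h l x) _)
  d_bar h k := le_antisymm (dist_le_bar h k) (bar_le_iff.2 (dist_le_bar k h))

/-- A contraction `f` into the space of forms extends along an isometry `g` by
`z ↦ ⨅ w, f w * d (g w) z`. -/
theorem exists_extension {E₁ E₂ : Type*} [HMetricSpace H E₁] [HMetricSpace H E₂]
    {f : E₁ → Form H E} {g : E₁ → E₂} (hf : IsContraction H f) (hg : IsIsometry H g) :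
    ∃ k : E₂ → Form H E, IsContraction H k ∧ k ∘ g = f := by
  let F : E₂ → E → H := fun z x => ⨅ w, (f w).toFun x * d (g w) z
  have hF : ∀ z x y, (d x y : H) ≤ F z x * bar (F z y) := fun z x y => by
    simp only [F]
    rw [iInf_mul]
    refine le_iInf fun w => ?_
    rw [bar_iInf, mul_iInf]
    refine le_iInf fun w' => ?_
    have h₁ : (d (f w) (f w') : H) ≤ d (g w) z * bar (d (g w') z) := by
      rw [← d_bar]
      exact (hf w w').trans ((hg w w').symm.le.trans (d_triangle _ _ _))
    calc (d x y : H) ≤ (f w').toFun x * bar ((f w').toFun y) := (f w').d_le x y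
      _ ≤ (f w).toFun x * d (f w) (f w') * bar ((f w').toFun y) :=
        mul_le_mul_left (le_mul_dist _ _ x) _
      _ ≤ (f w).toFun x * (d (g w) z * bar (d (g w') z)) * bar ((f w').toFun y) :=
        mul_le_mul_left (mul_le_mul_right h₁ _) _
      _ = (f w).toFun x * d (g w) z * bar ((f w').toFun y * d (g w') z) := by
        rw [bar_mul]; simp only [mul_assoc]
  have hle : ∀ z z' x, F z' x ≤ F z x * d z z' := fun z z' x => by
    simp only [F]
    rw [iInf_mul]
    refine le_iInf fun w => (iInf_le _ w).trans ?_
    rw [mul_assoc]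
    exact mul_le_mul_right (d_triangle _ _ _) _
  refine ⟨fun z => ⟨F z, hF z⟩, fun z z' => dist_le (fun x => ?_) (hle z z'), ?_⟩
  · rw [← d_bar]
    exact hle z' z x
  · refine funext fun w => Form.ext (funext fun x => le_antisymm ?_ (le_iInf fun w' => ?_))
    · refine (iInf_le _ w).trans ?_
      rw [d_self, mul_one]
    · exact (le_mul_dist _ _ x).trans (mul_le_mul_right ((hf w' w).trans (hg w' w).symm.le) _)

/-! ### Retracting the space of forms onto the minimal forms -/

open Classical in
/-- The form `h` with its value at `x₀` lowered as far as the other values permit. -/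
noncomputable def lower (x₀ : E) (h : Form H E) : Form H E where
  toFun := Function.update h.toFun x₀ (sInf {r | ∀ y, d x₀ y ≤ r * bar (h.toFun y)})
  d_le := by
    have key : ∀ y, (d x₀ y : H) ≤
        sInf {r | ∀ y, d x₀ y ≤ r * bar (h.toFun y)} * bar (h.toFun y) := fun y => by
      rw [sInf_eq_iInf', iInf_mul]
      exact le_iInf fun r => r.2 y
    intro x y
    rcases eq_or_ne x x₀ with rfl | hx <;> rcases eq_or_ne y x with rfl | hy
    · rw [d_self]
      exact InvolutiveHeyting.one_le _
    · rw [Function.update_self, Function.update_of_ne hy]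
      exact key y
    · rw [d_self]
      exact InvolutiveHeyting.one_le _
    · rw [Function.update_of_ne hx]
      rcases eq_or_ne y x₀ with rfl | hy'
      · rw [Function.update_self, d_bar]
        refine bar_le_iff.2 ?_
        rw [bar_mul, bar_bar]
        exact key x
      · rw [Function.update_of_ne hy']
        exact h.d_le x y

theorem lower_apply (x₀ : E) (h : Form H E) :
    (lower x₀ h).toFun x₀ = sInf {r | ∀ y, d x₀ y ≤ r * bar (h.toFun y)} := by
  simp only [lower, Function.update_self]

theorem lower_apply_of_ne {x x₀ : E} (hx : x ≠ x₀) (h : Form H E) :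
    (lower x₀ h).toFun x = h.toFun x := by
  simp only [lower, ne_eq, hx, not_false_eq_true, Function.update_of_ne]

theorem lower_le (x₀ : E) (h : Form H E) : lower x₀ h ≤ h := fun x => by
  rcases eq_or_ne x x₀ with rfl | hx
  · exact (lower_apply x h).trans_le (sInf_le fun y => h.d_le x y)
  · exact (lower_apply_of_ne hx h).le

theorem isMin_iff {h : Form H E} :
    IsMin h ↔ ∀ x r, (∀ y, d x y ≤ r * bar (h.toFun y)) → h.toFun x ≤ r := by
  refine ⟨fun hm x r hr => ?_, fun hh k hk x => hh x _ fun y => ?_⟩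
  · exact (hm (lower_le x h) x).trans ((lower_apply x h).trans_le (sInf_le hr))
  · exact (k.d_le x y).trans (mul_le_mul_right (bar_mono _ _ (hk y)) _)

theorem toFun_le_lower_mul (x₀ : E) {h k : Form H E} {r : H} (x : E)
    (h₁ : ∀ x, h.toFun x ≤ k.toFun x * bar r) (h₂ : ∀ x, k.toFun x ≤ h.toFun x * r) :
    (lower x₀ k).toFun x ≤ (lower x₀ h).toFun x * r := by
  rcases eq_or_ne x x₀ with rfl | hx
  · rw [lower_apply, lower_apply, sInf_eq_iInf' (s := {r | ∀ y, d x y ≤ r * bar (h.toFun y)}),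
      iInf_mul]
    refine le_iInf fun s => sInf_le fun y => (s.2 y).trans ?_
    rw [mul_assoc]
    refine mul_le_mul_right ((bar_mono _ _ (h₁ y)).trans_eq ?_) _
    rw [bar_mul, bar_bar]
  · rw [lower_apply_of_ne hx, lower_apply_of_ne hx]
    exact h₂ x

theorem lower_isContraction (x₀ : E) :
    IsContraction H (lower x₀ : Form H E → Form H E) := fun h k =>
  dist_le
    (fun x => toFun_le_lower_mul x₀ x (fun x => by rw [bar_bar]; exact le_mul_dist h k x)
      (le_mul_bar_dist h k))
    (fun x => toFun_le_lower_mul x₀ x (le_mul_bar_dist h k) (le_mul_dist h k))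

/-- There is a contraction of the space of forms that sends every form to a minimal form below it.
A minimal element among the contractions `p` with `p h ≤ h` has this property, since composing it
with `lower x₀` does not change it. -/
theorem exists_tightening : ∃ p : Form H E → Form H E,
    IsContraction H p ∧ (∀ h, p h ≤ h) ∧ ∀ h, IsMin (p h) := by
  let P := {p : Form H E → Form H E // IsContraction H p ∧ ∀ h, p h ≤ h}
  have : Nonempty P := ⟨⟨id, fun _ _ => le_rfl, fun _ => le_rfl⟩⟩
  obtain ⟨p, hp⟩ : ∃ p : P, ∀ q : P, (∀ h, q.1 h ≤ p.1 h) → ∀ h, p.1 h ≤ q.1 h := by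
    refine exists_maximal_of_nonempty_chains_bounded (r := fun p q : P => ∀ h, q.1 h ≤ p.1 h)
      (fun c hc ⟨p₀, hp₀⟩ => ?_) fun h₁ h₂ h => (h₂ h).trans (h₁ h)
    let F : Form H E → E → H := fun h x => ⨅ p : c, (p.1.1 h).toFun x
    have hF : ∀ h x y, (d x y : H) ≤ F h x * bar (F h y) := fun h x y => by
      simp only [F]
      rw [iInf_mul]
      refine le_iInf fun p => ?_
      rw [bar_iInf, mul_iInf]
      refine le_iInf fun q => ?_
      rcases hc.total p.2 q.2 with hpq | hpq
      · exact ((q.1.1 h).d_le x y).trans (mul_le_mul_left (hpq h x) _)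
      · exact ((p.1.1 h).d_le x y).trans (mul_le_mul_right (bar_mono _ _ (hpq h y)) _)
    refine ⟨⟨fun h => ⟨F h, hF h⟩, fun h k => dist_le (fun x => ?_) fun x => ?_, fun h x =>
      (iInf_le _ ⟨p₀, hp₀⟩).trans (p₀.2.2 h x)⟩, fun p hpc h x =>
        iInf_le (fun p : c => (p.1.1 h).toFun x) ⟨p, hpc⟩⟩
    · simp only [F]
      rw [iInf_mul]
      exact le_iInf fun p => (iInf_le _ p).trans ((le_mul_bar_dist _ _ x).trans
        (mul_le_mul_right (bar_mono _ _ (p.1.2.1 h k)) _))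
    · simp only [F]
      rw [iInf_mul]
      exact le_iInf fun p => (iInf_le _ p).trans ((le_mul_dist _ _ x).trans
        (mul_le_mul_right (p.1.2.1 h k) _))
  refine ⟨p.1, p.2.1, p.2.2, fun h => isMin_iff.2 fun x r hr => ?_⟩
  let q : P := ⟨fun h => lower x (p.1 h), fun h k =>
    (lower_isContraction x _ _).trans (p.2.1 h k), fun h => (lower_le x _).trans (p.2.2 h)⟩
  exact (hp q (fun h => lower_le x _) h x).trans ((lower_apply x _).trans_le (sInf_le hr))

end Form

/-! ### The tight span -/

variable (H E) in
/-- The tight span of `E`: the space of pointwise minimal forms. -/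
def TightSpan := {h : Form H E // IsMin h}

namespace TightSpan

/-- The tight span carries the distance of the space of forms. -/
instance : HMetricSpace H (TightSpan H E) where
  d h k := d h.1 k.1
  d_eq_one h k := (d_eq_one h.1 k.1).trans Subtype.ext_iff.symm
  d_triangle h k l := d_triangle h.1 k.1 l.1
  d_bar h k := d_bar h.1 k.1

theorem le_d_mul (h : TightSpan H E) (x y : E) : h.1.toFun x ≤ d x y * h.1.toFun y := by
  refine Form.isMin_iff.1 h.2 x _ fun z => (d_triangle x z y).trans ?_
  rw [mul_assoc]
  exact mul_le_mul_right (h.1.d_le y z) _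

variable (H E) in
/-- The Kuratowski map, which sends a point to the distances to it. -/
def kuratowski (z : E) : TightSpan H E :=
  ⟨⟨fun x => d x z, fun x y => by rw [← d_bar]; exact d_triangle x y z⟩, fun k hk x => by
    have hz : k.toFun z = 1 :=
      le_antisymm ((hk z).trans_eq (d_self z)) (InvolutiveHeyting.one_le _)
    simpa only [hz, bar_one, mul_one] using k.d_le x z⟩

theorem kuratowski_apply (x z : E) : (kuratowski H E z).1.toFun x = d x z := rfl

theorem d_kuratowski_le (z : E) (h : TightSpan H E) :
    (d (kuratowski H E z) h : H) ≤ h.1.toFun z :=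
  Form.dist_le (fun x => h.1.d_le x z) fun x => le_d_mul h x z

theorem kuratowski_isIsometry : IsIsometry H (kuratowski H E) := fun x y => by
  refine le_antisymm (d_kuratowski_le x _) ?_
  have := Form.le_mul_dist (kuratowski H E x).1 (kuratowski H E y).1 x
  rwa [kuratowski_apply, kuratowski_apply, d_self, one_mul] at this

/-- A contraction out of the tight span that is isometric on `E` is an isometry: the distances from
`E` to the image of a point `h` constitute a form below `h`, so they agree with `h`. -/
theorem isIsometry_of_comp_kuratowski {E' : Type w} [HMetricSpace H E'] {g : TightSpan H E → E'}
    (hg : IsContraction H g) (hgk : IsIsometry H (g ∘ kuratowski H E)) : IsIsometry H g := by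
  have key : ∀ (h : TightSpan H E) (x : E),
      h.1.toFun x ≤ d (g (kuratowski H E x)) (g h) := fun h =>
    h.2 (b := ⟨fun x => d (g (kuratowski H E x)) (g h), fun x y => by
      rw [← d_bar, ← hgk]
      exact d_triangle _ _ _⟩) fun x => (hg _ _).trans (d_kuratowski_le x h)
  have le : ∀ (h k : TightSpan H E) (x : E), k.1.toFun x ≤ h.1.toFun x * d (g h) (g k) :=
    fun h k x => (key k x).trans ((d_triangle _ _ (g h)).trans
      (mul_le_mul_left ((hg _ _).trans (d_kuratowski_le x h)) _))
  refine fun h k => le_antisymm (hg h k) (Form.dist_le (fun x => ?_) (le h k))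
  rw [← d_bar]
  exact le k h x

end TightSpan

end Spaces

/-! ### Existence and uniqueness of injective envelopes -/

section Envelopes

variable {H : Type u} [InvolutiveHeyting H]

theorem TightSpan.isInjectiveSpace (E : Type u) [HMetricSpace H E] :
    IsInjectiveSpace H (TightSpan H E) := by
  intro E₁ E₂ _ _ f g hf hg
  obtain ⟨p, hp, hle, hmin⟩ := Form.exists_tightening (H := H) (E := E)
  obtain ⟨k, hk, hkg⟩ := Form.exists_extension (f := fun w => (f w).1) hf hg
  refine ⟨fun z => ⟨p (k z), hmin _⟩, fun z z' => (hp _ _).trans (hk z z'),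
    funext fun w => Subtype.ext ?_⟩
  have e : k (g w) = (f w).1 := congrFun hkg w
  change p (k (g w)) = (f w).1
  rw [e]
  exact (f w).2.eq_of_le (hle _)

theorem TightSpan.isInjectiveEnvelope (E : Type u) [HMetricSpace H E] :
    IsInjectiveEnvelope H (TightSpan.kuratowski H E) := by
  refine ⟨⟨kuratowski_isIsometry.isContraction, fun E'' _ g hg =>
    ⟨isIsometry_of_comp_kuratowski hg, fun h x y => ?_⟩⟩, TightSpan.isInjectiveSpace E⟩
  exact (h _ _).trans (kuratowski_isIsometry x y)

theorem IsEssential.isIsometry {E N : Type v} [HMetricSpace H E] [HMetricSpace H N] {f : E → N}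
    (hf : IsEssential H f) : IsIsometry H f :=
  (hf.2 N id fun _ _ => le_rfl).2 fun _ _ => rfl

theorem IsInjectiveEnvelope.exists_surjective_isometry {E N N' : Type v} [HMetricSpace H E]
    [HMetricSpace H N] [HMetricSpace H N'] {f : E → N} {f' : E → N'}
    (hf : IsInjectiveEnvelope H f) (hf' : IsInjectiveEnvelope H f') :
    ∃ φ : N → N', Function.Surjective φ ∧ IsIsometry H φ ∧ φ ∘ f = f' := by
  obtain ⟨φ, hφ, hφf⟩ := hf'.2 E N f' f hf'.1.1 hf.1.isIsometry
  have hφi : IsIsometry H φ := (hf.1.2 N' φ hφ).1 (by rw [hφf]; exact hf'.1.isIsometry)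
  -- a left inverse `ψ` of `φ` is isometric on `E`, hence injective, so `φ` is onto
  obtain ⟨ψ, hψ, hψφ⟩ := hf.2 N N' id φ (fun _ _ => le_rfl) hφi
  have hψi : IsIsometry H ψ := by
    refine (hf'.1.2 N ψ hψ).1 ?_
    rw [← hφf, ← Function.comp_assoc, hψφ]
    exact hf.1.isIsometry
  exact ⟨φ, fun y => ⟨ψ y, hψi.injective (congrFun hψφ (ψ y))⟩, hφi, hφf⟩

end Envelopes

/-! ### Well-quasi-ordered alphabets -/

section Alphabet

variable {A : Type u} [OrderedAlphabet A]

theorem Word.wellQuasiOrderedLE [WellQuasiOrderedLE A] : WellQuasiOrderedLE (Word A) := by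
  refine ⟨Set.partiallyWellOrderedOn_univ_iff.1 ?_⟩
  refine ((Set.isPWO_of_wellQuasiOrderedLE (Set.univ : Set A)
    ).partiallyWellOrderedOn_sublistForall₂ (· ≤ ·)).mono fun l _ a _ => Set.mem_univ a

theorem Word.exists_of_le_mul {α β γ : Word A} (h : γ ≤ α * β) :
    ∃ α' β' : Word A, α' ≤ α ∧ β' ≤ β ∧ α' * β' = γ := by
  obtain ⟨l, hl, hs⟩ := List.sublistForall₂_iff.1 h
  obtain ⟨l₁, l₂, rfl, h₁, h₂⟩ := List.sublist_append_iff.1 hs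
  refine ⟨Word.ofList (γ.toList.take l₁.length), Word.ofList (γ.toList.drop l₁.length),
    List.sublistForall₂_iff.2 ⟨l₁, ?_, h₁⟩, List.sublistForall₂_iff.2 ⟨l₂, ?_, h₂⟩,
    List.take_append_drop _ _⟩
  · simpa [Word.ofList, Word.toList] using List.forall₂_take l₁.length hl
  · simpa [Word.ofList, Word.toList] using List.forall₂_drop l₁.length hl

/-- The right quotient `{α | α * β ∈ X}` of a final segment by a word. -/
def rightQuotient (X : FinalSegments A) (β : Word A) : FinalSegments A where
  carrier := {α | α * β ∈ X}
  upper' := fun _ _ h hα => X.upper (Word.mul_le_mul h le_rfl) hα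

theorem mem_rightQuotient {X : FinalSegments A} {α β : Word A} :
    α ∈ rightQuotient X β ↔ α * β ∈ X := Iff.rfl

/-- A right quotient of `X` is generated by the prefixes of the finitely many minimal words of `X`
whose complementary suffix is below the word divided by. -/
theorem finite_range_rightQuotient [WellQuasiOrderedLE A] (X : FinalSegments A) :
    (Set.range (rightQuotient X)).Finite := by
  have := Word.wellQuasiOrderedLE (A := A)
  let M : Set (Word A) := {u | Minimal (· ∈ X) u}
  have hM : M.Finite := WellQuasiOrderedLE.finite_of_isAntichain (setOfPred_minimal_antichain _)
  let T : Set (Word A) := {α | ∃ β, α * β ∈ M}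
  have hT : T.Finite := by
    refine (hM.biUnion fun u _ => List.finite_toSet u.toList.inits).subset ?_
    rintro α ⟨β, hαβ⟩
    exact Set.mem_biUnion hαβ ((List.mem_inits _ _).2 (List.prefix_append (Word.toList α) β.toList))
  refine (hT.finite_subsets.image upperClosure).subset ?_
  rintro _ ⟨β, rfl⟩
  refine ⟨{α | ∃ β', β' ≤ β ∧ α * β' ∈ M}, fun α ⟨β', _, h⟩ => ⟨β', h⟩, ?_⟩
  refine SetLike.ext fun α => ?_
  rw [mem_upperClosure, mem_rightQuotient]
  constructor
  · rintro ⟨α', ⟨β', hβ', hM'⟩, hα'⟩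
    exact X.upper (Word.mul_le_mul hα' hβ') hM'.prop
  · intro h
    obtain ⟨u, hu, hmin⟩ := exists_minimal_le_of_wellFoundedLT (· ∈ X) (α * β) h
    obtain ⟨α', β', hα', hβ', rfl⟩ := Word.exists_of_le_mul hu
    exact ⟨α', ⟨β', hβ', hmin⟩, hα'⟩

/-- A minimal form over `F(A*)` takes its values among the intersections of right quotients of the
distances of the space. -/
theorem Form.toFun_eq_sSup {E : Type v} [HMetricSpace (FinalSegments A) E]
    {h : Form (FinalSegments A) E} (hh : IsMin h) (x : E) :
    h.toFun x = sSup {X | (∃ y, X ∈ Set.range (rightQuotient (d x y))) ∧ X ≤ h.toFun x} := by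
  refine le_antisymm (Form.isMin_iff.1 hh x _ fun y => ?_) (sSup_le fun X hX => hX.2)
  rintro _ ⟨α, hα, β, hβ, rfl⟩
  have hle : rightQuotient (d x y) β ≤ h.toFun x := fun γ hγ =>
    h.d_le x y ⟨γ, hγ, β, hβ, rfl⟩
  exact UpperSet.mem_sSup_iff.1 hα _ ⟨⟨y, β, rfl⟩, hle⟩

theorem TightSpan.finite [WellQuasiOrderedLE A] (E : Type v) [HMetricSpace (FinalSegments A) E]
    [Finite E] : Finite (TightSpan (FinalSegments A) E) := by
  let R : E → Set (FinalSegments A) := fun x => ⋃ y, Set.range (rightQuotient (d x y))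
  have hR : ∀ x, (sSup '' {S | S ⊆ R x}).Finite := fun x =>
    (Set.finite_iUnion fun y => finite_range_rightQuotient (d x y)).finite_subsets.image _
  have hfin := Set.Finite.pi' hR
  have : Finite {φ : E → FinalSegments A | ∀ x, φ x ∈ sSup '' {S | S ⊆ R x}} := hfin
  refine Finite.of_injective (fun h : TightSpan (FinalSegments A) E =>
    (⟨h.1.toFun, fun x => ⟨_, fun X hX => Set.mem_iUnion.2 hX.1,
      (Form.toFun_eq_sSup h.2 x).symm⟩⟩ :
      {φ : E → FinalSegments A | ∀ x, φ x ∈ sSup '' {S | S ⊆ R x}})) fun h k e => ?_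
  exact Subtype.ext (Form.ext (congrArg Subtype.val e))

/-! ### Alphabets that are not well-quasi-ordered -/

open Classical in
theorem Word.le_countP_of_replicate_le {n : ℕ} {b : A} {γ : Word A}
    (h : Word.ofList (List.replicate n b) ≤ γ) : n ≤ γ.toList.countP (b ≤ ·) := by
  obtain ⟨l, hl, hs⟩ := List.sublistForall₂_iff.1 h
  change List.Forall₂ (· ≤ ·) (List.replicate n b) l at hl
  have hlen : n = l.length := by simpa using hl.length_eq
  have hall : ∀ c ∈ l, b ≤ c := fun c hc => by
    obtain ⟨i, hi, rfl⟩ := List.getElem_of_mem hc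
    simpa using hl.get (i := i) (by simpa [hlen] using hi) hi
  calc n = l.countP (b ≤ ·) := by
        rw [hlen, eq_comm, List.countP_eq_length]
        simpa using hall
    _ ≤ γ.toList.countP (b ≤ ·) := hs.countP_le

/-- The `n`-th letter of a sequence, repeated `n + 1` times. -/
def powerWord (a : ℕ → A) (n : ℕ) : Word A := Word.ofList (List.replicate (n + 1) (a n))

/-- The final segment generated by the squares of the words `powerWord a n`. -/
def powerSquares (a : ℕ → A) : FinalSegments A :=
  upperClosure (Set.range fun n => powerWord a n * powerWord a n)

theorem mul_self_mem_powerSquares (a : ℕ → A) (n : ℕ) :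
    powerWord a n * powerWord a n ∈ powerSquares a :=
  subset_upperClosure ⟨n, rfl⟩

open Classical in
theorem exists_le_countP_of_mem_powerSquares {a : ℕ → A} {γ : Word A}
    (h : γ ∈ powerSquares a) : ∃ k, 2 * (k + 1) ≤ γ.toList.countP (a k ≤ ·) := by
  obtain ⟨_, ⟨k, rfl⟩, hk⟩ := mem_upperClosure.1 h
  refine ⟨k, Word.le_countP_of_replicate_le (le_trans (le_of_eq ?_) hk)⟩
  rw [two_mul]
  exact List.replicate_add _ _ _

theorem eq_of_mul_mem_powerSquares {a : ℕ → A} (ha : ∀ m n, m < n → ¬ a m ≤ a n) {m n : ℕ}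
    (h : powerWord a m * powerWord a n ∈ powerSquares a) : m = n := by
  classical
  obtain ⟨k, hk⟩ := exists_le_countP_of_mem_powerSquares h
  have hle : ∀ i, a k ≤ a i → i ≤ k := fun i hi => not_lt.1 fun hlt => ha k i hlt hi
  change 2 * (k + 1) ≤ List.countP _ (List.replicate (m + 1) (a m) ++
    List.replicate (n + 1) (a n)) at hk
  rw [List.countP_append, List.countP_replicate, List.countP_replicate] at hk
  have hm := hle m
  have hn := hle n
  simp only [decide_eq_true_eq] at hk
  split_ifs at hk with h₁ h₂ h₂
  · have := hm h₁
    have := hn h₂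
    omega
  · have := hm h₁
    omega
  · have := hn h₂
    omega
  · omega

theorem powerSquares_ne_one (a : ℕ → A) : powerSquares a ≠ 1 := fun h => by
  classical
  have h₁ : (1 : Word A) ∈ powerSquares a := by
    rw [h, FinalSegments.one_def]
    exact UpperSet.mem_bot
  obtain ⟨k, hk⟩ := exists_le_countP_of_mem_powerSquares h₁
  rw [Word.toList_one, List.countP_nil] at hk
  omega

/-- The two-point space whose points `true` and `false` have distance `X ≠ 1`, in this order. -/
@[reducible]
def twoPointSpace (X : FinalSegments A) (hX : X ≠ 1) :
    HMetricSpace (FinalSegments A) (ULift.{u} Bool) where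
  d x y := if x = y then 1 else if x.down then X else bar X
  d_eq_one := by
    have hX' : bar X ≠ 1 := fun h => hX (by rw [← bar_bar X, h, bar_one])
    rintro ⟨_ | _⟩ ⟨_ | _⟩ <;> simp [hX, hX']
  d_triangle := by
    have := fun Y : FinalSegments A => InvolutiveHeyting.one_le Y
    rintro ⟨_ | _⟩ ⟨_ | _⟩ ⟨_ | _⟩ <;> simp [this]
  d_bar := by
    rintro ⟨_ | _⟩ ⟨_ | _⟩ <;> simp [bar_one, bar_bar]

/-- For a bad sequence `a` in `A`, the tight span of the two-point space with distance
`powerSquares a` is infinite. -/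
theorem TightSpan.infinite_twoPointSpace {a : ℕ → A} (ha : ∀ m n, m < n → ¬ a m ≤ a n) :
    let := twoPointSpace _ (powerSquares_ne_one a)
    Infinite (TightSpan (FinalSegments A) (ULift.{u} Bool)) := by
  let := twoPointSpace _ (powerSquares_ne_one a)
  obtain ⟨p, -, hle, hmin⟩ :=
    Form.exists_tightening (H := FinalSegments A) (E := ULift.{u} Bool)
  -- the distances to a point that the square of `powerWord a n` allows between the two points
  let F : ℕ → ULift.{u} Bool → FinalSegments A := fun n x =>
    if x.down then UpperSet.Ici (powerWord a n) else bar (UpperSet.Ici (powerWord a n))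
  have key : ∀ n, powerSquares a ≤
      UpperSet.Ici (powerWord a n) * UpperSet.Ici (powerWord a n) := by
    rintro n _ ⟨α, hα, β, hβ, rfl⟩
    exact (powerSquares a).upper (Word.mul_le_mul hα hβ) (mul_self_mem_powerSquares a n)
  have hF : ∀ n x y, (d x y : FinalSegments A) ≤ F n x * bar (F n y) := by
    have h₁ := fun Y : FinalSegments A => InvolutiveHeyting.one_le Y
    rintro n ⟨_ | _⟩ ⟨_ | _⟩
    · exact h₁ _
    · change bar (powerSquares a) ≤ bar _ * bar _
      rw [← bar_mul]
      exact bar_mono _ _ (key n)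
    · change powerSquares a ≤ _ * bar (bar _)
      rw [bar_bar]
      exact key n
    · exact h₁ _
  let t : ℕ → TightSpan (FinalSegments A) (ULift.{u} Bool) := fun n => ⟨p ⟨F n, hF n⟩, hmin _⟩
  have h₀ : ∀ n, powerWord a n ∈ (t n).1.toFun ⟨true⟩ := fun n =>
    hle ⟨F n, hF n⟩ ⟨true⟩ (UpperSet.mem_Ici_iff.2 le_rfl)
  have h₁ : ∀ n, powerWord a n ∈ bar ((t n).1.toFun ⟨false⟩) := fun n => by
    refine (bar_mono _ _ (hle ⟨F n, hF n⟩ ⟨false⟩)).trans_eq (bar_bar _) ?_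
    exact UpperSet.mem_Ici_iff.2 le_rfl
  refine Infinite.of_injective t fun m n hmn => eq_of_mul_mem_powerSquares ha ?_
  exact (t m).1.d_le ⟨true⟩ ⟨false⟩ ⟨_, h₀ m, _, hmn ▸ h₁ n, rfl⟩

end Alphabet

end FinalSegmentMetric

theorem mainTheorem4 (A : Type u) [OrderedAlphabet A] :
    -- every finite metric space over `F(A*)` has an injective envelope, unique up to an
    -- isomorphism which is the identity on the space
    (∀ (E : Type u) [HMetricSpace (FinalSegments A) E] [Finite E],
      (∃ (N : Type u) (_ : HMetricSpace (FinalSegments A) N) (f : E → N),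
        IsInjectiveEnvelope (FinalSegments A) f) ∧
      (∀ (N N' : Type u) [HMetricSpace (FinalSegments A) N] [HMetricSpace (FinalSegments A) N']
        (f : E → N) (f' : E → N'), IsInjectiveEnvelope (FinalSegments A) f →
        IsInjectiveEnvelope (FinalSegments A) f' →
        ∃ φ : N → N', Function.Surjective φ ∧ IsIsometry (FinalSegments A) φ ∧ φ ∘ f = f')) ∧
    -- the alphabet is w.q.o. iff the injective envelope of every finite metric space is finite
    (WellQuasiOrderedLE A ↔
      ∀ (E : Type u) [HMetricSpace (FinalSegments A) E] [Finite E]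
        (N : Type u) [HMetricSpace (FinalSegments A) N] (f : E → N),
        IsInjectiveEnvelope (FinalSegments A) f → Finite N) := by
  refine ⟨fun E _ _ => ⟨⟨_, _, _, TightSpan.isInjectiveEnvelope E⟩,
    fun N N' _ _ f f' hf hf' => hf.exists_surjective_isometry hf'⟩, fun hA E _ _ N _ f hf => ?_,
    fun h => ?_⟩
  · obtain ⟨φ, -, hφ, -⟩ := hf.exists_surjective_isometry (TightSpan.isInjectiveEnvelope E)
    have := TightSpan.finite (A := A) E
    exact Finite.of_injective φ hφ.injective
  · by_contra hA
    obtain ⟨a, ha⟩ : ∃ a : ℕ → A, ∀ m n, m < n → ¬ a m ≤ a n := by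
      by_contra! hc
      exact hA ⟨hc⟩
    let := twoPointSpace _ (powerSquares_ne_one a)
    have : Finite (ULift.{u} Bool) := Finite.of_equiv _ Equiv.ulift.symm
    have := TightSpan.infinite_twoPointSpace ha
    have := h _ _ _ (TightSpan.isInjectiveEnvelope (H := FinalSegments A) (ULift.{u} Bool))
    exact not_finite (TightSpan (FinalSegments A) (ULift.{u} Bool))
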